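/- **Conventions.** Work in the nonstandard extensions ${}^*\mathbb N,{}^*\mathbb R$ (ultrapowers along a nonprincipal ultrafilter on $\mathbb N$). A hyperreal is *limited* if it is bounded in absolute value by a standard real, *infinitesimal* if its absolute value is smaller than every standard $r>0$, and *appreciable* if it is limited and not infinitesimal. The *halo* (monad) of $x$ is the set of $y$ with $y-x$ infinitesimal. Let $N\in{}^*\mathbb N$ be unlimited and let $I=\{0,\frac1N,\dots,\frac{N-1}N,1\}$. All functions on $I$ and all subsets of $I$ over which one integrates are internal. Put $\int_A f\,d\lambda=\frac1N\sum_{\tau\in A,\ \tau\ne1}f(\tau)$, $\lambda(A)=\int_A 1\,d\lambda$ and $\int_0^t f\,d\tau=\int_{I\cap[0,t)}f\,d\lambda$. * A (possibly external) set $E\subseteq I$ is *rare* if for every standard $r>0$ it is contained in an internal set of measure at most $r$. An internal $A\subseteq I$ is *quadrable* if the set of points of $I$ that are infinitely close both to a point of $A$ and to a point of $I\setminus A$ is rare. * $f:I\to{}^*\mathbb R$ is *$S$-integrable* if $\int_I|f|\,d\lambda$ is limited and $\int_A|f|\,d\lambda$ is infinitesimal whenever $\lambda(A)$ is. * A *zero-mean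 noise* is an $S$-integrable $\mathfrak n:I\to{}^*\mathbb R$ such that $\int_A\mathfrak n\,d\lambda$ is infinitesimal for every quadrable $A\subseteq I$. * A function $\bar\delta:[0,1]\to\mathbb R$ is the *shadow* of $\delta:I\to{}^*\mathbb R$ if $\delta(t)$ is in the halo of $\bar\delta(x)$ whenever $t\in I$ is in the halo of $x\in[0,1]$. Let $\theta\in\mathbb R$. An *estimator* of $\theta$ is given by a zero-mean noise $\mathfrak n$, a function $\delta:I\to{}^*\mathbb R$ whose shadow $\bar\delta$ (the *divisor*) is real analytic on $[0,1]$ with $\bar\delta(0)=0$, and a function $[\theta]_e:I\to{}^*\mathbb R$, related by $$\delta(t)\bigl([\theta]_e(t)-\theta\bigr)=\sum_{i=1}^{r}c_i\int_0^t\int_0^{\tau_{k_i}}\!\!\cdots\int_0^{\tau_2}\tau_1^{\nu_i}\,\mathfrak n(\tau_1)\,d\tau_1\,d\tau_2\cdots d\tau_{k_i},\tag{$*$}$$ a finite sum of $k_i$-fold iterated integrals with limited $c_i\in{}^*\mathbb R$ and integers $\nu_i\ge0$, $k_i\ge1$; for $k_i=1$ the integral is $\int_0^t\tau_1^{\nu_i}\mathfrak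 n(\tau_1)\,d\tau_1$. The interval $[0,t]$, $t\in I$, is the *estimation window*, of length $t$. **Proposition.** 1. Let $t\in I$ be a point at which $(*)$ holds and which is not in the halo of any zero of $\bar\delta$ in $[0,1]$. Then $[\theta]_e(t)$ is in the halo of $\theta$, and $t$ is appreciable. 2. If $t$ is infinitesimal, $[\theta]_e(t)$ need not be in the halo of $\theta$. More precisely, for every unlimited $N$, every $\theta\in\mathbb R$ and every infinitesimal $t\in I$ with $t>0$, there is an estimator as above, satisfying $(*)$ at every point of $I$, whose divisor vanishes only at $0$ and for which $\delta(s)\neq0$ for all $s\in I$ with $s>0$, such that $[\theta]_e(t)$ is not in the halo of $\theta$. -/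

import Mathlib

noncomputable section

namespace NonstandardNoise

open Filter

/-- The nonstandard extension `*α`, as an ultrapower along the nonprincipal ultrafilter on `ℕ` that
Mathlib uses for the hyperreals; `ℝ*` is by definition `NSExt ℝ`. The elements of `NSExt (ℝ → ℝ)` and
`NSExt (Set ℝ)` are the internal functions `ℝ* → ℝ*` and the internal subsets of `ℝ*`. -/
abbrev NSExt (α : Type) : Type := Germ (hyperfilter ℕ : Filter ℕ) α

/-- The inclusion `*ℕ → *ℝ`. -/
def hypernatToHyperreal (k : NSExt ℕ) : Hyperreal := Germ.map (fun m : ℕ => (m : ℝ)) k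

/-- The value at `t` of an internal function. -/
def eval (f : NSExt (ℝ → ℝ)) (t : Hyperreal) : Hyperreal :=
  Germ.map₂ (fun (g : ℝ → ℝ) (x : ℝ) => g x) f t

/-- Membership in an internal set. -/
def InternalMem (t : Hyperreal) (A : NSExt (Set ℝ)) : Prop :=
  Germ.LiftRel (fun (x : ℝ) (B : Set ℝ) => x ∈ B) t A

/-! ### Orders of magnitude -/

def Limited (x : Hyperreal) : Prop := ∃ r : ℝ, |x| ≤ (r : Hyperreal)

def Infinitesimal (x : Hyperreal) : Prop := ∀ r : ℝ, 0 < r → |x| < (r : Hyperreal)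

def Appreciable (x : Hyperreal) : Prop := Limited x ∧ ¬ Infinitesimal x

/-- The halo (monad) of `x`. -/
def halo (x : Hyperreal) : Set Hyperreal := {y | Infinitesimal (y - x)}

/-- A hypernatural number is unlimited if it exceeds every standard natural number. -/
def Unlimited (N : NSExt ℕ) : Prop := ∀ m : ℕ, (Germ.const m : NSExt ℕ) < N

/-! ### The hyperfinite time grid and its Lebesgue measure -/

/-- The hyperfinite grid `{0, 1/N, …, (N-1)/N, 1}`. -/
def grid (N : NSExt ℕ) : Set Hyperreal :=
  {t | ∃ k : NSExt ℕ, k ≤ N ∧ t = hypernatToHyperreal k / hypernatToHyperreal N}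

/-- For a standard `M`: the sum of `g x / M` over the points `x` of `{0, 1/M, …, (M-1)/M}` that lie
in `A`. -/
def gridIntegral (M : ℕ) (A : Set ℝ) (g : ℝ → ℝ) : ℝ :=
  ∑ k ∈ Finset.range M, A.indicator g ((k : ℝ) / (M : ℝ)) / (M : ℝ)

/-- `∫_A f dλ`, where `λ` gives the mass `1/N` to each grid point other than `1`. -/
def integral (N : NSExt ℕ) (A : NSExt (Set ℝ)) (f : NSExt (ℝ → ℝ)) : Hyperreal :=
  Germ.map₂ (fun (p : ℕ × Set ℝ) (g : ℝ → ℝ) => gridIntegral p.1 p.2 g)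
    (Germ.map₂ Prod.mk N A) f

/-- `λ(A)`. -/
def measure (N : NSExt ℕ) (A : NSExt (Set ℝ)) : Hyperreal :=
  integral N A (Germ.const (fun _ : ℝ => (1 : ℝ)))

/-- The internal function `|f|`. -/
def absFun (f : NSExt (ℝ → ℝ)) : NSExt (ℝ → ℝ) :=
  Germ.map (fun (g : ℝ → ℝ) (x : ℝ) => |g x|) f

/-- An external set of grid points is rare if, for every standard `r > 0`, some internal set of
measure at most `r` covers it. -/
def Rare (N : NSExt ℕ) (E : Set Hyperreal) : Prop :=
  ∀ r : ℝ, 0 < r → ∃ B : NSExt (Set ℝ),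
    (∀ x ∈ E, InternalMem x B) ∧ measure N B ≤ (r : Hyperreal)

/-- The grid points that are infinitely close both to a grid point of `A` and to a grid point
outside `A`. -/
def boundary (N : NSExt ℕ) (A : NSExt (Set ℝ)) : Set Hyperreal :=
  {x | x ∈ grid N ∧ (∃ y ∈ grid N, InternalMem y A ∧ y ∈ halo x) ∧
    ∃ z ∈ grid N, ¬ InternalMem z A ∧ z ∈ halo x}

/-- An internal set of grid points is quadrable if its boundary is rare. -/
def Quadrable (N : NSExt ℕ) (A : NSExt (Set ℝ)) : Prop := Rare N (boundary N A)

/-- `S`-integrability of an internal function on the grid. -/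
def SIntegrable (N : NSExt ℕ) (f : NSExt (ℝ → ℝ)) : Prop :=
  Limited (integral N (Germ.const (Set.univ : Set ℝ)) (absFun f)) ∧
    ∀ A : NSExt (Set ℝ), Infinitesimal (measure N A) → Infinitesimal (integral N A (absFun f))

/-- Lebesgue integrability: `S`-integrable, and `S`-continuous outside a rare set. -/
def LebesgueIntegrable (N : NSExt ℕ) (f : NSExt (ℝ → ℝ)) : Prop :=
  SIntegrable N f ∧ ∃ E : Set Hyperreal, Rare N E ∧
    ∀ x ∈ grid N, ∀ y ∈ grid N, x ∉ E → y ∉ E → y ∈ halo x → eval f y ∈ halo (eval f x)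

/-! ### Noises -/

def FastOscillating (N : NSExt ℕ) (f : NSExt (ℝ → ℝ)) : Prop :=
  SIntegrable N f ∧ ∀ A : NSExt (Set ℝ), Quadrable N A → Infinitesimal (integral N A f)

/-- `n` is a noise of mean `m` on the one-dimensional grid. -/
def IsNoise (N : NSExt ℕ) (n m : NSExt (ℝ → ℝ)) : Prop :=
  LebesgueIntegrable N m ∧ SIntegrable N n ∧ FastOscillating N (n - m)

def IsZeroMeanNoise (N : NSExt ℕ) (n : NSExt (ℝ → ℝ)) : Prop := IsNoise N n 0

/-! ### Estimators -/

/-- The internal function `t ↦ ∫_0^t f dλ`, the integral being over the grid points of `[0, t)`. -/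
def primitive (N : NSExt ℕ) (f : NSExt (ℝ → ℝ)) : NSExt (ℝ → ℝ) :=
  Germ.map₂ (fun (M : ℕ) (g : ℝ → ℝ) (t : ℝ) => gridIntegral M (Set.Ico 0 t) g) N f

/-- The internal function `τ ↦ τ ^ ν`. -/
def monomial (ν : ℕ) : NSExt (ℝ → ℝ) := Germ.const (fun x : ℝ => x ^ ν)

/-- The data `c`, `ν`, `k` of a term `c ∫_0^t ⋯ ∫_0^{τ₂} τ₁ ^ ν n(τ₁) dτ₁ ⋯ dτ_k`. A limited
element of `*ℕ` is standard, so `ν` and `k` are in `ℕ`. -/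
structure EstimTerm where
  c : Hyperreal
  ν : ℕ
  k : ℕ

def EstimTerm.Admissible (p : EstimTerm) : Prop := Limited p.c ∧ 1 ≤ p.k

/-- The value at `t` of the `k`-fold iterated integral of `τ ^ ν n(τ)`, multiplied by `c`. -/
def EstimTerm.value (N : NSExt ℕ) (n : NSExt (ℝ → ℝ)) (t : Hyperreal) (p : EstimTerm) : Hyperreal :=
  p.c * eval ((primitive N)^[p.k] (monomial p.ν * n)) t

/-- The relation `δ(t) ([θ]_e(t) - θ) = ∑ c ∫_0^t ⋯ ∫_0^{τ₂} τ₁ ^ ν n(τ₁) dτ₁ ⋯ dτ_k`. -/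
def EstimatorEq (N : NSExt ℕ) (θ : ℝ) (n δ est : NSExt (ℝ → ℝ)) (terms : List EstimTerm)
    (t : Hyperreal) : Prop :=
  eval δ t * (eval est t - (θ : Hyperreal)) = (terms.map (EstimTerm.value N n t)).sum

/-- The standard function `g` on `[0, 1]` is the shadow of the internal function `f`. -/
def IsShadow (N : NSExt ℕ) (f : NSExt (ℝ → ℝ)) (g : ℝ → ℝ) : Prop :=
  ∀ t ∈ grid N, ∀ x ∈ Set.Icc (0 : ℝ) 1, t ∈ halo (x : Hyperreal) →
    eval f t ∈ halo (g x : Hyperreal)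

/-- `d` is the divisor given by `δ`: the shadow of `δ`, analytic on `[0, 1]` and zero at `0`. -/
def IsDivisor (N : NSExt ℕ) (δ : NSExt (ℝ → ℝ)) (d : ℝ → ℝ) : Prop :=
  IsShadow N δ d ∧ AnalyticOn ℝ d (Set.Icc 0 1) ∧ d 0 = 0

end NonstandardNoise

end

/-!
For grid points `t`, the boundary of `[0, t)` lies in the halo of `t`, so `[0, t)` is quadrable and
a zero-mean noise `n` has an infinitesimal primitive on the whole grid. A bound for the primitive
of `n` gives, by Abel summation, twice that bound for the primitive of `τ ^ ν n`, and integrating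
again does not increase it. Hence `δ(t) ([θ]_e(t) - θ)` is infinitesimal, while `δ(t)` is infinitely
close to `d(x) ≠ 0`, where `x` is the standard part of `t`.

The indicator function of an infinitesimal window `[0, t)` is itself a zero-mean noise, but it
shifts the mean over that window by exactly `1`.
-/

noncomputable section

namespace NonstandardNoise

open Filter

section Magnitude

open ArchimedeanClass

variable {x y : Hyperreal}

theorem infinitesimal_iff_mk_pos : Infinitesimal x ↔ 0 < ArchimedeanClass.mk x := by
  refine ⟨fun h => ?_, fun h r hr => ?_⟩
  · rw [← mk_one, mk_lt_mk]
    intro n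
    have hx : |x| < ((n : Hyperreal) + 1)⁻¹ := h (n + 1)⁻¹ (by positivity)
    calc n • |x| ≤ (n + 1) • |x| := nsmul_le_nsmul_left (abs_nonneg x) n.le_succ
      _ = |x| * ((n : Hyperreal) + 1) := by rw [nsmul_eq_mul, mul_comm, Nat.cast_succ]
      _ < |1| := by rwa [abs_one, ← lt_div_iff₀ (by positivity), one_div]
  · exact lt_of_pos_of_archimedean Hyperreal.coeRingHom (by rwa [mk_abs]) hr

theorem limited_iff_mk_nonneg : Limited x ↔ 0 ≤ ArchimedeanClass.mk x := by
  refine ⟨fun ⟨r, hr⟩ => ?_, fun h => ?_⟩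
  · rw [← mk_abs]
    exact mk_nonneg_of_le_of_le_of_archimedean Hyperreal.coeRingHom (abs_nonneg x) hr
  · obtain ⟨n, hn⟩ := exists_nat_ge_of_mk_nonneg (x := |x|) (by rwa [mk_abs])
    exact ⟨n, hn⟩

theorem Infinitesimal.limited (hx : Infinitesimal x) : Limited x :=
  limited_iff_mk_nonneg.2 (infinitesimal_iff_mk_pos.1 hx).le

theorem Infinitesimal.of_abs_le (hy : Infinitesimal y) (hxy : |x| ≤ y) : Infinitesimal x :=
  fun r hr => (hxy.trans (le_abs_self y)).trans_lt (hy r hr)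

theorem Limited.mul_infinitesimal (hx : Limited x) (hy : Infinitesimal y) :
    Infinitesimal (x * y) := by
  rw [limited_iff_mk_nonneg] at hx
  rw [infinitesimal_iff_mk_pos] at hy ⊢
  rw [mk_mul]
  exact hy.trans_le (le_add_of_nonneg_left hx)

theorem Infinitesimal.list_sum {l : List Hyperreal} (h : ∀ x ∈ l, Infinitesimal x) :
    Infinitesimal l.sum := by
  have mem_ball {x : Hyperreal} :
      x ∈ ballAddSubgroup (0 : ArchimedeanClass Hyperreal) ↔ Infinitesimal x := by
    rw [mem_ballAddSubgroup_iff zero_ne_top, infinitesimal_iff_mk_pos]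
  exact mem_ball.1 (list_sum_mem fun x hx => mem_ball.2 (h x hx))

theorem mk_eq_zero_of_mem_halo {a : ℝ} (hx : x ∈ halo (a : Hyperreal)) (ha : a ≠ 0) :
    ArchimedeanClass.mk x = 0 := by
  have ha' : ArchimedeanClass.mk (a : Hyperreal) = 0 := Hyperreal.archimdeanClassMk_coe ha
  rw [← ha', ← sub_add_cancel x a]
  refine mk_add_eq_mk_right ?_
  rw [ha']
  exact infinitesimal_iff_mk_pos.1 hx

theorem Infinitesimal.of_mul_left {a : ℝ} (h : Infinitesimal (x * y))
    (hx : x ∈ halo (a : Hyperreal)) (ha : a ≠ 0) : Infinitesimal y := by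
  rw [infinitesimal_iff_mk_pos, mk_mul, mk_eq_zero_of_mem_halo hx ha, zero_add] at h
  exact infinitesimal_iff_mk_pos.2 h

theorem exists_mem_Icc_mem_halo {a b : ℝ} (hx : x ∈ Set.Icc (a : Hyperreal) b) :
    ∃ c ∈ Set.Icc a b, x ∈ halo (c : Hyperreal) := by
  have h : 0 ≤ ArchimedeanClass.mk x :=
    mk_nonneg_of_le_of_le_of_archimedean Hyperreal.coeRingHom hx.1 hx.2
  refine ⟨stdPart x, ⟨?_, ?_⟩, ?_⟩
  · exact le_stdPart_of_le Hyperreal.coeRingHom h hx.1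
  · exact stdPart_le_of_le Hyperreal.coeRingHom h hx.2
  · exact infinitesimal_iff_mk_pos.2 (mk_sub_stdPart_pos Hyperreal.coeRingHom h)

end Magnitude

theorem eval_coe (f : ℕ → ℝ → ℝ) (t : ℕ → ℝ) :
    eval (f : NSExt (ℝ → ℝ)) (Hyperreal.ofSeq t) = Hyperreal.ofSeq fun m => f m (t m) :=
  rfl

theorem eval_const (c : ℝ) (t : Hyperreal) : eval (Germ.const fun _ => c) t = c := by
  induction t using Germ.inductionOn with
  | h t => rfl

theorem eval_const_id (t : Hyperreal) : eval (Germ.const id) t = t := by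
  induction t using Germ.inductionOn with
  | h t => rfl

theorem integral_coe (M : ℕ → ℕ) (A : ℕ → Set ℝ) (f : ℕ → ℝ → ℝ) :
    integral (M : NSExt ℕ) (A : NSExt (Set ℝ)) (f : NSExt (ℝ → ℝ)) =
      Hyperreal.ofSeq fun m => gridIntegral (M m) (A m) (f m) :=
  rfl

theorem primitive_coe (M : ℕ → ℕ) (f : ℕ → ℝ → ℝ) :
    primitive (M : NSExt ℕ) (f : NSExt (ℝ → ℝ)) =
      ((fun m t => gridIntegral (M m) (Set.Ico 0 t) (f m) : ℕ → ℝ → ℝ) : NSExt (ℝ → ℝ)) :=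
  rfl

theorem abs_ofSeq (t : ℕ → ℝ) : |Hyperreal.ofSeq t| = Hyperreal.ofSeq fun m => |t m| :=
  Germ.abs_def _

theorem mem_grid_coe {M : ℕ → ℕ} {t : Hyperreal} :
    t ∈ grid (M : NSExt ℕ) ↔
      ∃ k : ℕ → ℕ, (∀ m, k m ≤ M m) ∧ t = Hyperreal.ofSeq fun m => (k m : ℝ) / M m := by
  refine ⟨?_, ?_⟩
  · rintro ⟨k, hk, rfl⟩
    induction k using Germ.inductionOn with
    | h k =>
      refine ⟨fun m => min (k m) (M m), fun m => min_le_right _ _, Germ.coe_eq.2 ?_⟩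
      filter_upwards [Germ.coe_le.1 hk] with m hm
      rw [min_eq_left hm]
      rfl
  · rintro ⟨k, hk, rfl⟩
    exact ⟨(k : NSExt ℕ), Germ.coe_le.2 (Eventually.of_forall hk), rfl⟩

theorem mem_Icc_of_mem_grid {N : NSExt ℕ} {t : Hyperreal} (ht : t ∈ grid N) :
    t ∈ Set.Icc ((0 : ℝ) : Hyperreal) (1 : ℝ) := by
  induction N using Germ.inductionOn with
  | h M =>
    obtain ⟨k, hk, rfl⟩ := mem_grid_coe.1 ht
    have hmem (m : ℕ) : (k m : ℝ) / M m ∈ Set.Icc (0 : ℝ) 1 :=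
      ⟨by positivity, div_le_one_of_le₀ (Nat.cast_le.2 (hk m)) (Nat.cast_nonneg _)⟩
    exact ⟨Germ.coe_le.2 (Eventually.of_forall fun m => (hmem m).1),
      Germ.coe_le.2 (Eventually.of_forall fun m => (hmem m).2)⟩

theorem eventually_forall_le_iff {ι : Type*} {l : Filter ι} {M : ι → ℕ} {P : ι → ℕ → Prop} :
    (∀ᶠ m in l, ∀ k ≤ M m, P m k) ↔
      ∀ k : ι → ℕ, (∀ m, k m ≤ M m) → ∀ᶠ m in l, P m (k m) := by
  refine ⟨fun h k hk => h.mono fun m hm => hm _ (hk m), fun h => ?_⟩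
  have hworst : ∀ m, ∃ k ≤ M m, P m k → ∀ j ≤ M m, P m j := by
    intro m
    by_cases hall : ∀ j ≤ M m, P m j
    · exact ⟨0, Nat.zero_le _, fun _ => hall⟩
    · push Not at hall
      obtain ⟨j, hj, hPj⟩ := hall
      exact ⟨j, hj, fun hP => absurd hP hPj⟩
  choose k hk hP using hworst
  exact (h k hk).mono hP

theorem forall_mem_grid_abs_eval_le_iff {M : ℕ → ℕ} {f : ℕ → ℝ → ℝ} {C : ℕ → ℝ} :
    (∀ s ∈ grid (M : NSExt ℕ), |eval (f : NSExt (ℝ → ℝ)) s| ≤ Hyperreal.ofSeq C) ↔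
      ∀ᶠ m in (hyperfilter ℕ : Filter ℕ), ∀ k ≤ M m, |f m (k / M m)| ≤ C m := by
  rw [eventually_forall_le_iff]
  refine ⟨fun h k hk => ?_, fun h s hs => ?_⟩
  · have := h _ (mem_grid_coe.2 ⟨k, hk, rfl⟩)
    rwa [eval_coe, abs_ofSeq, Hyperreal.ofSeq_le_ofSeq] at this
  · obtain ⟨k, hk, rfl⟩ := mem_grid_coe.1 hs
    rw [eval_coe, abs_ofSeq, Hyperreal.ofSeq_le_ofSeq]
    exact h k hk

/-! ### Finite grid sums -/

section GridIntegral

variable {M k : ℕ}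

theorem gridIntegral_Ico (hk : k ≤ M) (g : ℝ → ℝ) :
    gridIntegral M (Set.Ico 0 ((k : ℝ) / M)) g = ∑ j ∈ Finset.range k, g (j / M) / M := by
  rcases M.eq_zero_or_pos with rfl | hM
  · obtain rfl : k = 0 := by omega
    simp [gridIntegral]
  have hmem (j : ℕ) : (j : ℝ) / M ∈ Set.Ico 0 ((k : ℝ) / M) ↔ j ∈ Finset.range k := by
    rw [Set.mem_Ico, and_iff_right (by positivity), div_lt_div_iff_of_pos_right (by positivity),
      Nat.cast_lt, Finset.mem_range]
  rw [gridIntegral, ← Finset.sum_subset (Finset.range_subset_range.2 hk)]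
  · exact Finset.sum_congr rfl fun j hj => by rw [Set.indicator_of_mem ((hmem j).2 hj)]
  · intro j _ hj
    rw [Set.indicator_of_notMem (mt (hmem j).1 hj), zero_div]

theorem gridIntegral_one_Ico_le {a b : ℝ} (hab : a ≤ b) (hb : 0 ≤ b) :
    gridIntegral M (Set.Ico a b) (fun _ => 1) ≤ b - a + 1 / M := by
  classical
  rcases M.eq_zero_or_pos with rfl | hM
  · simpa [gridIntegral] using hab
  have hM' : (0 : ℝ) < M := Nat.cast_pos.2 hM
  have hsub : ({j ∈ Finset.range M | (j : ℝ) / M ∈ Set.Ico a b} : Finset ℕ) ⊆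
      Finset.Ico ⌈a * M⌉₊ ⌈b * M⌉₊ := by
    intro j hj
    obtain ⟨-, haj, hjb⟩ := Finset.mem_filter.1 hj
    rw [Finset.mem_Ico, Nat.ceil_le, Nat.lt_ceil]
    exact ⟨(le_div_iff₀ hM').1 haj, (div_lt_iff₀ hM').1 hjb⟩
  have hcard : ((⌈b * M⌉₊ - ⌈a * M⌉₊ : ℕ) : ℝ) ≤ (b - a) * M + 1 := by
    rw [Nat.cast_sub (Nat.ceil_le_ceil (by gcongr))]
    linarith [Nat.ceil_lt_add_one (mul_nonneg hb hM'.le), Nat.le_ceil (a * M)]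
  calc gridIntegral M (Set.Ico a b) (fun _ => 1)
      = ({j ∈ Finset.range M | (j : ℝ) / M ∈ Set.Ico a b} : Finset ℕ).card / (M : ℝ) := by
        rw [gridIntegral, ← Finset.sum_div]
        simp only [Set.indicator_apply, Finset.sum_boole]
    _ ≤ (⌈b * M⌉₊ - ⌈a * M⌉₊ : ℕ) / (M : ℝ) := by
        rw [← Nat.card_Ico]
        gcongr
    _ ≤ ((b - a) * M + 1) / M := by gcongr
    _ = b - a + 1 / M := by field_simp

theorem abs_gridIntegral_le (M : ℕ) (A : Set ℝ) (g : ℝ → ℝ) :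
    |gridIntegral M A g| ≤ gridIntegral M Set.univ fun x => |g x| := by
  refine (Finset.abs_sum_le_sum_abs _ _).trans (Finset.sum_le_sum fun k _ => ?_)
  rw [abs_div, Nat.abs_cast, Set.indicator_univ]
  exact div_le_div_of_nonneg_right (norm_indicator_le_norm_self g _) (Nat.cast_nonneg M)

theorem abs_gridIntegral_Ico_le {f : ℝ → ℝ} {C : ℝ} (hk : k ≤ M)
    (hf : ∀ j ≤ M, |f (j / M)| ≤ C) : |gridIntegral M (Set.Ico 0 (k / M)) f| ≤ C := by
  have hC : 0 ≤ C := (abs_nonneg _).trans (hf 0 M.zero_le)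
  rw [gridIntegral_Ico hk, ← Finset.sum_div, abs_div, Nat.abs_cast]
  refine div_le_of_le_mul₀ (Nat.cast_nonneg M) hC ?_
  calc |∑ j ∈ Finset.range k, f (j / M)| ≤ ∑ _ ∈ Finset.range k, C :=
        (Finset.abs_sum_le_sum_abs _ _).trans <| Finset.sum_le_sum fun j hj =>
          hf j ((Finset.mem_range.1 hj).le.trans hk)
    _ = k * C := by simp
    _ ≤ C * M := by rw [mul_comm]; gcongr

theorem norm_sum_range_smul_le {E : Type*} [SeminormedAddCommGroup E] [NormedSpace ℝ E] {a : ℕ → ℝ}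
    {b : ℕ → E} {n : ℕ} {C : ℝ} (ha : MonotoneOn a (Set.Iic n)) (ha₀ : 0 ≤ a 0)
    (hb : ∀ k ≤ n, ‖∑ i ∈ Finset.range k, b i‖ ≤ C) :
    ‖∑ i ∈ Finset.range n, a i • b i‖ ≤ 2 * a n * C := by
  have hC : 0 ≤ C := (norm_nonneg _).trans (hb 0 n.zero_le)
  have hpred : n - 1 ≤ n := n.sub_le 1
  have hnonneg : 0 ≤ a (n - 1) := ha₀.trans (ha n.zero_le hpred (Nat.zero_le _))
  have hlast : a (n - 1) ≤ a n := ha hpred (le_refl n) hpred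
  have hfirst : ‖a (n - 1) • ∑ i ∈ Finset.range n, b i‖ ≤ a (n - 1) * C := by
    rw [norm_smul, Real.norm_of_nonneg hnonneg]
    exact mul_le_mul_of_nonneg_left (hb n le_rfl) hnonneg
  have hsecond : ‖∑ i ∈ Finset.range (n - 1), (a (i + 1) - a i) •
      ∑ j ∈ Finset.range (i + 1), b j‖ ≤ (a (n - 1) - a 0) * C := by
    rw [← Finset.sum_range_sub, Finset.sum_mul]
    refine norm_sum_le_of_le _ fun i hi => ?_
    have hin : i + 1 ≤ n := (Nat.succ_le_of_lt (Finset.mem_range.1 hi)).trans hpred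
    have hdiff : 0 ≤ a (i + 1) - a i := sub_nonneg.2 (ha (i.le_succ.trans hin) hin i.le_succ)
    rw [norm_smul, Real.norm_of_nonneg hdiff]
    exact mul_le_mul_of_nonneg_left (hb _ hin) hdiff
  rw [Finset.sum_range_by_parts]
  calc _ ≤ a (n - 1) * C + (a (n - 1) - a 0) * C := norm_sub_le_of_le hfirst hsecond
    _ = 2 * a (n - 1) * C - a 0 * C := by ring
    _ ≤ 2 * a (n - 1) * C := sub_le_self _ (mul_nonneg ha₀ hC)
    _ ≤ 2 * a n * C := by gcongr

theorem abs_gridIntegral_Ico_mul_le {f g : ℝ → ℝ} {C : ℝ} (hk : k ≤ M)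
    (hg : MonotoneOn g (Set.Icc 0 1)) (hg₀ : 0 ≤ g 0)
    (hf : ∀ j ≤ M, |gridIntegral M (Set.Ico 0 (j / M)) f| ≤ C) :
    |gridIntegral M (Set.Ico 0 (k / M)) (g * f)| ≤ 2 * g 1 * C := by
  have hC : 0 ≤ C := (abs_nonneg _).trans (hf 0 M.zero_le)
  have hmem {j : ℕ} (hj : j ≤ M) : (j : ℝ) / M ∈ Set.Icc (0 : ℝ) 1 :=
    ⟨by positivity, div_le_one_of_le₀ (Nat.cast_le.2 hj) (Nat.cast_nonneg M)⟩
  have habel : ‖∑ j ∈ Finset.range k, g (j / M) • (f (j / M) / M)‖ ≤ 2 * g (k / M) * C := by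
    refine norm_sum_range_smul_le (a := fun j => g (j / M)) (fun _ hi _ hj hij => ?_) ?_ ?_
    · exact hg (hmem (hi.trans hk)) (hmem (hj.trans hk)) (by gcongr)
    · simpa using hg₀
    · intro j hj
      rw [← gridIntegral_Ico (hj.trans hk)]
      exact hf j (hj.trans hk)
  have hle : g (k / M) ≤ g 1 := hg (hmem hk) (Set.right_mem_Icc.2 zero_le_one) (hmem hk).2
  rw [gridIntegral_Ico hk]
  simp only [Pi.mul_apply, mul_div_assoc]
  exact habel.trans (by gcongr)

end GridIntegral

/-! ### Iterated integrals -/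

section Primitive

variable {N : NSExt ℕ} {f : NSExt (ℝ → ℝ)}

theorem abs_eval_primitive_le {C : Hyperreal} (hf : ∀ s ∈ grid N, |eval f s| ≤ C) :
    ∀ t ∈ grid N, |eval (primitive N f) t| ≤ C := by
  obtain ⟨c, rfl⟩ := Hyperreal.ofSeq_surjective C
  induction N, f using Germ.inductionOn₂ with
  | h M f =>
    rw [forall_mem_grid_abs_eval_le_iff] at hf
    rw [primitive_coe, forall_mem_grid_abs_eval_le_iff]
    exact hf.mono fun m hm k hk => abs_gridIntegral_Ico_le hk hm

theorem abs_eval_iterate_primitive_le {C : Hyperreal} (hf : ∀ s ∈ grid N, |eval f s| ≤ C) (k : ℕ) :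
    ∀ t ∈ grid N, |eval ((primitive N)^[k] f) t| ≤ C := by
  induction k with
  | zero => exact hf
  | succ k ih =>
    rw [Function.iterate_succ_apply']
    exact abs_eval_primitive_le ih

theorem abs_eval_primitive_const_mul_le {C : Hyperreal} {g : ℝ → ℝ}
    (hg : MonotoneOn g (Set.Icc 0 1)) (hg₀ : 0 ≤ g 0)
    (hf : ∀ s ∈ grid N, |eval (primitive N f) s| ≤ C) :
    ∀ t ∈ grid N, |eval (primitive N (Germ.const g * f)) t| ≤ 2 * (g 1 : Hyperreal) * C := by
  obtain ⟨c, rfl⟩ := Hyperreal.ofSeq_surjective C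
  induction N, f using Germ.inductionOn₂ with
  | h M f =>
    rw [primitive_coe, forall_mem_grid_abs_eval_le_iff] at hf
    change ∀ t ∈ grid _, |eval (primitive M ((fun m => g * f m : ℕ → ℝ → ℝ) : NSExt (ℝ → ℝ))) t| ≤
      Hyperreal.ofSeq fun m => 2 * g 1 * c m
    rw [primitive_coe, forall_mem_grid_abs_eval_le_iff]
    exact hf.mono fun m hm k hk => abs_gridIntegral_Ico_mul_le hk hg hg₀ hm

theorem infinitesimal_eval_iterate_primitive
    (hf : ∀ s ∈ grid N, Infinitesimal (eval (primitive N f) s)) (ν : ℕ) {k : ℕ} (hk : 1 ≤ k)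
    {t : Hyperreal} (ht : t ∈ grid N) :
    Infinitesimal (eval ((primitive N)^[k] (monomial ν * f)) t) := by
  obtain ⟨k, rfl⟩ := Nat.exists_eq_add_of_le' hk
  intro r hr
  have hmul : ∀ s ∈ grid N, |eval (primitive N (monomial ν * f)) s| ≤ (r / 2 : ℝ) := by
    have hmono : MonotoneOn (fun x : ℝ => x ^ ν) (Set.Icc 0 1) :=
      fun x hx y _ hxy => pow_le_pow_left₀ hx.1 hxy ν
    have hC : 2 * ((1 ^ ν : ℝ) : Hyperreal) * (r / 4 : ℝ) = (r / 2 : ℝ) := by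
      rw [one_pow]; push_cast; ring
    rw [← hC]
    exact abs_eval_primitive_const_mul_le hmono (by positivity)
      fun s hs => (hf s hs (r / 4) (by positivity)).le
  rw [Function.iterate_succ_apply]
  exact (abs_eval_iterate_primitive_le hmul k t ht).trans_lt
    (Hyperreal.coe_lt_coe.2 (half_lt_self hr))

end Primitive

section Interval

variable {N : NSExt ℕ} {s t x : Hyperreal}

/-- The interval `[s, t)` of `ℝ*` as an internal set. -/
def internalIco (s t : Hyperreal) : NSExt (Set ℝ) := Germ.map₂ Set.Ico s t

theorem internalMem_internalIco : InternalMem x (internalIco s t) ↔ s ≤ x ∧ x < t := by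
  induction s, t, x using Germ.inductionOn₃ with
  | H s t x => exact eventually_and.trans (and_congr Germ.coe_le.symm Germ.coe_lt.symm)

theorem measure_internalIco_le (hst : s ≤ t) (ht : 0 ≤ t) :
    measure N (internalIco s t) ≤ t - s + (hypernatToHyperreal N)⁻¹ := by
  induction N, s, t using Germ.inductionOn₃ with
  | H M s t =>
    refine Germ.coe_le.2 ?_
    filter_upwards [Germ.coe_le.1 hst, Germ.coe_le.1 ht] with m hm hm₀
    exact (gridIntegral_one_Ico_le hm hm₀).trans_eq (by rw [one_div]; rfl)

theorem measure_internalIco_zero (ht : t ∈ grid N) : measure N (internalIco 0 t) = t := by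
  induction N using Germ.inductionOn with
  | h M =>
    obtain ⟨k, hk, rfl⟩ := mem_grid_coe.1 ht
    refine Germ.coe_eq.2 (Eventually.of_forall fun m => ?_)
    exact (gridIntegral_Ico (hk m) _).trans (by simp [div_eq_mul_inv])

theorem integral_internalIco_self (N : NSExt ℕ) (t : Hyperreal) (f : NSExt (ℝ → ℝ)) :
    integral N (internalIco t t) f = 0 := by
  induction N, t, f using Germ.inductionOn₃ with
  | H M t f => exact Germ.coe_eq.2 (Eventually.of_forall fun m => by simp [gridIntegral])

theorem eval_primitive (N : NSExt ℕ) (f : NSExt (ℝ → ℝ)) (t : Hyperreal) :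
    eval (primitive N f) t = integral N (internalIco 0 t) f := by
  induction N, f, t using Germ.inductionOn₃ with
  | H M f t => rfl

theorem Unlimited.infinitesimal_inv (hN : Unlimited N) :
    Infinitesimal (hypernatToHyperreal N)⁻¹ := by
  intro r hr
  obtain ⟨b, hb⟩ := exists_nat_gt r⁻¹
  have hbN : ((b : ℝ) : Hyperreal) < hypernatToHyperreal N := by
    have := hN b
    induction N using Germ.inductionOn with
    | h M => exact Germ.coe_lt.2 ((Germ.coe_lt.1 this).mono fun m hm => Nat.cast_lt.2 hm)
  have hr' : 0 < ((r⁻¹ : ℝ) : Hyperreal) := Hyperreal.coe_pos.2 (inv_pos.2 hr)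
  have hrN := (Hyperreal.coe_lt_coe.2 hb).trans hbN
  rw [abs_of_pos (inv_pos.2 (hr'.trans hrN)), ← inv_inv r, Hyperreal.coe_inv]
  exact inv_strictAnti₀ hr' hrN

theorem infinitesimal_sub_of_mem_boundary_internalIco_zero
    (hx : x ∈ boundary N (internalIco 0 t)) : Infinitesimal (x - t) := by
  obtain ⟨-, ⟨y, -, hy, hyx⟩, z, hz, hzt, hzx⟩ := hx
  have hyt : y < t := (internalMem_internalIco.1 hy).2
  have htz : t ≤ z :=
    not_lt.1 fun h => hzt (internalMem_internalIco.2 ⟨(mem_Icc_of_mem_grid hz).1, h⟩)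
  intro r hr
  exact abs_lt.2 ⟨by linarith [(abs_lt.1 (hzx r hr)).2], by linarith [(abs_lt.1 (hyx r hr)).1]⟩

theorem quadrable_internalIco_zero (hN : Unlimited N) (ht : 0 ≤ t) :
    Quadrable N (internalIco 0 t) := by
  intro r hr
  have hr' : (0 : Hyperreal) < r := Hyperreal.coe_pos.2 hr
  have hN' := (abs_lt.1 (hN.infinitesimal_inv (r / 4) (by positivity))).2
  refine ⟨internalIco (t - r / 4) (t + r / 4), fun x hx => ?_, ?_⟩
  · have hxt := abs_lt.1
      (infinitesimal_sub_of_mem_boundary_internalIco_zero hx (r / 4) (by positivity))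
    push_cast at hxt
    exact internalMem_internalIco.2 ⟨by linarith, by linarith⟩
  · push_cast at hN'
    exact (measure_internalIco_le (by linarith) (by linarith)).trans (by linarith)

end Interval

/-! ### Zero-mean noises -/

section Noise

variable {N : NSExt ℕ} {n : NSExt (ℝ → ℝ)}

theorem integral_absFun_zero (N : NSExt ℕ) (A : NSExt (Set ℝ)) : integral N A (absFun 0) = 0 := by
  induction N, A using Germ.inductionOn₂ with
  | h M A => exact Germ.coe_eq.2 (Eventually.of_forall fun m => by simp [gridIntegral])

theorem rare_empty (N : NSExt ℕ) : Rare N ∅ := fun _ hr =>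
  ⟨internalIco 0 0, fun _ hx => hx.elim,
    (integral_internalIco_self N 0 _).trans_le (Hyperreal.coe_nonneg.2 hr.le)⟩

theorem lebesgueIntegrable_zero (N : NSExt ℕ) : LebesgueIntegrable N 0 := by
  have hzero : Infinitesimal 0 := fun _ hr => by rwa [abs_zero, Hyperreal.coe_pos]
  refine ⟨⟨?_, fun A _ => ?_⟩, ∅, rare_empty N, fun x _ y _ _ _ _ => ?_⟩
  · exact integral_absFun_zero N _ ▸ hzero.limited
  · exact integral_absFun_zero N A ▸ hzero
  · change Infinitesimal (eval (Germ.const fun _ => 0) y - eval (Germ.const fun _ => 0) x)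
    rwa [eval_const, eval_const, sub_self]

theorem isZeroMeanNoise_iff : IsZeroMeanNoise N n ↔ FastOscillating N n := by
  rw [IsZeroMeanNoise, IsNoise, sub_zero]
  exact ⟨fun h => h.2.2, fun h => ⟨lebesgueIntegrable_zero N, h.1, h⟩⟩

theorem abs_integral_le (N : NSExt ℕ) (A : NSExt (Set ℝ)) (f : NSExt (ℝ → ℝ)) :
    |integral N A f| ≤ integral N (Germ.const Set.univ) (absFun f) := by
  induction N, A, f using Germ.inductionOn₃ with
  | H M A f =>
    rw [integral_coe, abs_ofSeq]
    exact Germ.coe_le.2 (Eventually.of_forall fun m => abs_gridIntegral_le _ _ _)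

theorem absFun_absFun (f : NSExt (ℝ → ℝ)) : absFun (absFun f) = absFun f := by
  induction f using Germ.inductionOn with
  | h f => exact Germ.coe_eq.2 (Eventually.of_forall fun m => funext fun x => abs_abs _)

theorem fastOscillating_of_infinitesimal_integral_absFun
    (h : Infinitesimal (integral N (Germ.const Set.univ) (absFun n))) : FastOscillating N n := by
  refine ⟨⟨h.limited, fun A _ => h.of_abs_le ?_⟩, fun A _ => h.of_abs_le (abs_integral_le N A n)⟩
  simpa only [absFun_absFun] using abs_integral_le N A (absFun n)

/-- The indicator function of an internal set, as an internal function. -/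
def internalIndicator (A : NSExt (Set ℝ)) : NSExt (ℝ → ℝ) :=
  Germ.map (fun B : Set ℝ => B.indicator fun _ => 1) A

theorem absFun_internalIndicator (A : NSExt (Set ℝ)) :
    absFun (internalIndicator A) = internalIndicator A := by
  induction A using Germ.inductionOn with
  | h A =>
    refine Germ.coe_eq.2 (Eventually.of_forall fun m => funext fun x => ?_)
    exact abs_of_nonneg (Set.indicator_nonneg (fun _ _ => zero_le_one) x)

theorem integral_internalIndicator (N : NSExt ℕ) (A B : NSExt (Set ℝ)) :
    integral N A (internalIndicator B) = measure N (A ⊓ B) := by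
  induction N, A, B using Germ.inductionOn₃ with
  | H M A B =>
    refine Germ.coe_eq.2 (Eventually.of_forall fun m => ?_)
    simp [gridIntegral, Set.indicator_indicator]

theorem fastOscillating_internalIndicator {A : NSExt (Set ℝ)} (hA : Infinitesimal (measure N A)) :
    FastOscillating N (internalIndicator A) := by
  refine fastOscillating_of_infinitesimal_integral_absFun ?_
  rwa [absFun_internalIndicator, integral_internalIndicator,
    show Germ.const Set.univ = ⊤ from rfl, top_inf_eq]

end Noise

section Estimator

variable {N : NSExt ℕ} {n : NSExt (ℝ → ℝ)} {t : Hyperreal}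

theorem EstimTerm.Admissible.infinitesimal_value {p : EstimTerm} (hp : p.Admissible)
    (hn : ∀ s ∈ grid N, Infinitesimal (eval (primitive N n) s)) (ht : t ∈ grid N) :
    Infinitesimal (p.value N n t) :=
  hp.1.mul_infinitesimal (infinitesimal_eval_iterate_primitive hn p.ν hp.2 ht)

theorem mem_halo_of_estimatorEq {θ : ℝ} {δ est : NSExt (ℝ → ℝ)} {d : ℝ → ℝ} {terms : List EstimTerm}
    (hn : ∀ s ∈ grid N, Infinitesimal (eval (primitive N n) s)) (hδ : IsShadow N δ d)
    (hterms : ∀ p ∈ terms, p.Admissible) (ht : t ∈ grid N)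
    (heq : EstimatorEq N θ n δ est terms t)
    (hzero : ∀ z ∈ Set.Icc (0 : ℝ) 1, d z = 0 → t ∉ halo (z : Hyperreal)) :
    eval est t ∈ halo (θ : Hyperreal) := by
  obtain ⟨x, hx, htx⟩ := exists_mem_Icc_mem_halo (mem_Icc_of_mem_grid ht)
  have hsum : Infinitesimal (eval δ t * (eval est t - (θ : Hyperreal))) := by
    rw [heq]
    refine Infinitesimal.list_sum fun y hy => ?_
    obtain ⟨p, hp, rfl⟩ := List.mem_map.1 hy
    exact (hterms p hp).infinitesimal_value hn ht
  exact hsum.of_mul_left (hδ t ht x hx htx) fun h => hzero x hx h htx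

theorem limited_of_mem_grid (ht : t ∈ grid N) : Limited t := by
  obtain ⟨h₀, h₁⟩ := mem_Icc_of_mem_grid ht
  exact ⟨1, (abs_of_nonneg h₀).trans_le h₁⟩

theorem appreciable_of_notMem_halo_zero (ht : t ∈ grid N) (h : t ∉ halo ((0 : ℝ) : Hyperreal)) :
    Appreciable t :=
  ⟨limited_of_mem_grid ht, fun hinf => h (by simpa [halo] using hinf)⟩

end Estimator

section RunningMean

variable {N : NSExt ℕ} {t : Hyperreal}

/-- The running mean `t ↦ (1/t) ∫_0^t (θ + n) dλ` of the signal `θ` perturbed by the noise `n`: the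
estimator of `θ` with `δ(t) = t`. Its value at `t = 0` is `θ`, by the convention `x / 0 = 0`. -/
def runningMean (N : NSExt ℕ) (θ : ℝ) (n : NSExt (ℝ → ℝ)) : NSExt (ℝ → ℝ) :=
  Germ.const (fun _ => θ) + primitive N n / Germ.const id

theorem eval_runningMean (N : NSExt ℕ) (θ : ℝ) (n : NSExt (ℝ → ℝ)) (t : Hyperreal) :
    eval (runningMean N θ n) t = θ + integral N (internalIco 0 t) n / t := by
  rw [← eval_primitive]
  induction N, n, t using Germ.inductionOn₃ with
  | H M n t => rfl

theorem estimatorEq_runningMean (N : NSExt ℕ) (θ : ℝ) (n : NSExt (ℝ → ℝ)) (t : Hyperreal) :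
    EstimatorEq N θ n (Germ.const id) (runningMean N θ n) [⟨1, 0, 1⟩] t := by
  have hmul : monomial 0 * n = n := by
    rw [show monomial 0 = 1 from congrArg Germ.const (funext pow_zero), one_mul]
  have hvalue : EstimTerm.value N n t ⟨1, 0, 1⟩ = integral N (internalIco 0 t) n := by
    rw [EstimTerm.value, Function.iterate_one, hmul, one_mul, eval_primitive]
  rw [EstimatorEq, eval_const_id, eval_runningMean, add_sub_cancel_left, List.map_singleton,
    List.sum_singleton, hvalue]
  refine mul_div_cancel_of_imp' ?_
  rintro rfl
  exact integral_internalIco_self N 0 n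

theorem isDivisor_id (N : NSExt ℕ) : IsDivisor N (Germ.const id) id :=
  ⟨fun t _ x _ htx => by rwa [eval_const_id], analyticOn_id, rfl⟩

theorem eval_runningMean_internalIndicator (θ : ℝ) (ht : t ∈ grid N) (ht₀ : t ≠ 0) :
    eval (runningMean N θ (internalIndicator (internalIco 0 t))) t = θ + 1 := by
  rw [eval_runningMean, integral_internalIndicator, inf_idem, measure_internalIco_zero ht,
    div_self ht₀]

theorem add_one_notMem_halo (x : Hyperreal) : x + 1 ∉ halo x := fun h => by
  simpa using h 1 one_pos

end RunningMean

end NonstandardNoise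

end

open NonstandardNoise in
theorem proposition3_general (N : NSExt ℕ) (hN : Unlimited N) (θ : ℝ) :
    (∀ (n δ est : NSExt (ℝ → ℝ)) (d : ℝ → ℝ) (terms : List EstimTerm),
      (∀ A, Quadrable N A → Infinitesimal (integral N A n)) → IsShadow N δ d → d 0 = 0 →
      (∀ p ∈ terms, p.Admissible) →
      ∀ t ∈ grid N, EstimatorEq N θ n δ est terms t →
        (∀ z ∈ Set.Icc (0 : ℝ) 1, d z = 0 → t ∉ halo (z : Hyperreal)) →
        eval est t ∈ halo (θ : Hyperreal) ∧ Appreciable t) ∧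
    (∀ t ∈ grid N, 0 < t → Infinitesimal t →
      ∃ (n δ est : NSExt (ℝ → ℝ)) (d : ℝ → ℝ) (terms : List EstimTerm),
        IsZeroMeanNoise N n ∧ IsDivisor N δ d ∧ (∀ p ∈ terms, p.Admissible) ∧
        (∀ s ∈ grid N, EstimatorEq N θ n δ est terms s) ∧
        (∀ z ∈ Set.Icc (0 : ℝ) 1, d z = 0 → z = 0) ∧
        (∀ s ∈ grid N, 0 < s → eval δ s ≠ 0) ∧
        eval est t ∉ halo (θ : Hyperreal)) := by
  refine ⟨fun n δ est d terms hn hδ hd hterms t ht heq hzero => ?_, fun t ht hpos hinf => ?_⟩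
  · have hprim : ∀ s ∈ grid N, Infinitesimal (eval (primitive N n) s) := fun s hs => by
      rw [eval_primitive]
      exact hn _ (quadrable_internalIco_zero hN (mem_Icc_of_mem_grid hs).1)
    exact ⟨mem_halo_of_estimatorEq hprim hδ hterms ht heq hzero,
      appreciable_of_notMem_halo_zero ht (hzero 0 (Set.left_mem_Icc.2 zero_le_one) hd)⟩
  · let n := internalIndicator (internalIco 0 t)
    have hn : FastOscillating N n :=
      fastOscillating_internalIndicator (by rwa [measure_internalIco_zero ht])
    refine ⟨n, Filter.Germ.const id, runningMean N θ n, id, [⟨1, 0, 1⟩], isZeroMeanNoise_iff.2 hn,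
      isDivisor_id N, ?_, fun s _ => estimatorEq_runningMean N θ n s, fun z _ hz => hz, ?_, ?_⟩
    · exact List.forall_mem_singleton.2 ⟨⟨1, abs_one.le⟩, le_rfl⟩
    · exact fun s _ hs => by rw [eval_const_id]; exact hs.ne'
    · rw [eval_runningMean_internalIndicator θ ht hpos.ne']
      exact add_one_notMem_halo _
open NonstandardNoise in
theorem proposition3 (N : NSExt ℕ) (hN : Unlimited N) (θ : ℝ) :
    (∀ (n δ est : NSExt (ℝ → ℝ)) (d : ℝ → ℝ) (terms : List EstimTerm),
      IsZeroMeanNoise N n → IsDivisor N δ d → (∀ p ∈ terms, p.Admissible) →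
      ∀ t ∈ grid N, EstimatorEq N θ n δ est terms t →
        (∀ z ∈ Set.Icc (0 : ℝ) 1, d z = 0 → t ∉ halo (z : Hyperreal)) →
        eval est t ∈ halo (θ : Hyperreal) ∧ Appreciable t) ∧
    (∀ t ∈ grid N, 0 < t → Infinitesimal t →
      ∃ (n δ est : NSExt (ℝ → ℝ)) (d : ℝ → ℝ) (terms : List EstimTerm),
        IsZeroMeanNoise N n ∧ IsDivisor N δ d ∧ (∀ p ∈ terms, p.Admissible) ∧
        (∀ s ∈ grid N, EstimatorEq N θ n δ est terms s) ∧
        (∀ z ∈ Set.Icc (0 : ℝ) 1, d z = 0 → z = 0) ∧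
        (∀ s ∈ grid N, 0 < s → eval δ s ≠ 0) ∧
        eval est t ∉ halo (θ : Hyperreal)) := by
  exact ⟨fun n δ est d terms hn hδ => (proposition3_general N hN θ).1 n δ est d terms
    (isZeroMeanNoise_iff.1 hn).2 hδ.1 hδ.2.2, (proposition3_general N hN θ).2⟩
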